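/- Let $L$ be a first-order language (function symbols and predicate symbols with arities) with at least one predicate symbol of positive arity, and let terms be built from $L$ and countably many variables. Propositions are built from atomic propositions $P(t_1,\dots,t_n)$ and $\bot$ with $\Rightarrow,\wedge,\vee,\forall,\exists$, and are identified up to renaming of bound variables. A rewrite system $\mathcal R$ is a set of pairs of terms $l\to r$ such that $l$ is not a variable. Let $\to^1$ be the smallest relation on terms and on propositions that is compatible with their structure and satisfies $\theta l\to^1\theta r$ for each rule $l\to r$ of $\mathcal R$ and each substitution $\theta$, and let $\to^*$ be its reflexive-transitive closure. $\mathcal R$ is confluent if, for all terms $t,t_1,t_2$ with $t_1\leftarrow^* t\to^* t_2$, there is a term $s$ with $t_1\to^* s\leftarrow^* t_2$. Sequents $\Gamma\vdash\Delta$ are pairs of finite multisets of propositions. Asymmetric sequent calculus modulo $\mathcal R$ has the following rules (premises before the slash, conclusion after it): * Axiom: $/\;\Gamma,A_1\vdash A_2,\Delta$, if $A_1\to^* A\leftarrow^* A_2$ for some $A$. * Cut: $\Gamma\vdash C_1,\Delta$ and $\Gamma,C_2\vdash\Delta\;/\;\Gamma\vdash\Delta$, if $C_1\leftarrow^* C\to^*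 C_2$ for some $C$. * Contraction: $\Gamma,A_1,A_2\vdash\Delta\;/\;\Gamma,A\vdash\Delta$, and $\Gamma\vdash A_1,A_2,\Delta\;/\;\Gamma\vdash A,\Delta$, if $A_1\leftarrow^* A\to^* A_2$. * Weakening: $\Gamma\vdash\Delta\;/\;\Gamma,A\vdash\Delta$, and $\Gamma\vdash\Delta\;/\;\Gamma\vdash A,\Delta$. * If $C\to^* (A\Rightarrow B)$: $\Gamma\vdash A,\Delta$ and $\Gamma,B\vdash\Delta\;/\;\Gamma,C\vdash\Delta$; and $\Gamma,A\vdash B,\Delta\;/\;\Gamma\vdash C,\Delta$. * If $C\to^* (A\wedge B)$: $\Gamma,A,B\vdash\Delta\;/\;\Gamma,C\vdash\Delta$; and $\Gamma\vdash A,\Delta$ and $\Gamma\vdash B,\Delta\;/\;\Gamma\vdash C,\Delta$. * If $C\to^* (A\vee B)$: $\Gamma,A\vdash\Delta$ and $\Gamma,B\vdash\Delta\;/\;\Gamma,C\vdash\Delta$; and $\Gamma\vdash A,B,\Delta\;/\;\Gamma\vdash C,\Delta$. * If $A\to^*\bot$: $/\;\Gamma,A\vdash\Delta$. * If $B\to^*\forall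 x\,A$: $\Gamma,[t/x]A\vdash\Delta\;/\;\Gamma,B\vdash\Delta$ for any term $t$; and $\Gamma\vdash A,\Delta\;/\;\Gamma\vdash B,\Delta$ provided that $x$ is not free in $\Gamma,\Delta$. * If $B\to^*\exists x\,A$: $\Gamma,A\vdash\Delta\;/\;\Gamma,B\vdash\Delta$ provided that $x$ is not free in $\Gamma,\Delta$; and $\Gamma\vdash[t/x]A,\Delta\;/\;\Gamma\vdash B,\Delta$ for any term $t$. Then the cut rule is redundant, i.e. every sequent $\Gamma\vdash\Delta$ provable in this calculus has a proof that does not use the cut rule, if and only if $\mathcal R$ is confluent. -/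

import Mathlib

universe u v

namespace AsymmetricModulo

variable {L : FirstOrder.Language.{u, v}}

/-! ## First-order propositions

Terms are the terms `L.Term ℕ` of a first-order language with variables indexed by `ℕ`.
Propositions are represented up to renaming of bound variables, with de Bruijn indices: in the
body of a quantifier the variable `0` is the bound one, and the variable `k + 1` stands for the
variable `k` of the context of the quantifier. -/

/-- First-order propositions over the language `L`. -/
inductive Formula (L : FirstOrder.Language.{u, v}) : Type (max u v)
  | atom {n : ℕ} (P : L.Relations n) (ts : Fin n → L.Term ℕ) : Formula L
  | bot : Formula L
  | imp (A B : Formula L) : Formula L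
  | and (A B : Formula L) : Formula L
  | or (A B : Formula L) : Formula L
  | all (A : Formula L) : Formula L
  | ex (A : Formula L) : Formula L

/-- The substitution to be used in the body of a quantifier: it fixes the bound variable `0` and
acts as `σ` on the other variables, avoiding capture. -/
def up (σ : ℕ → L.Term ℕ) : ℕ → L.Term ℕ
  | 0 => FirstOrder.Language.Term.var 0
  | k + 1 => (σ k).relabel Nat.succ

/-- Simultaneous capture-avoiding substitution. -/
def Formula.subst : Formula L → (ℕ → L.Term ℕ) → Formula L
  | .atom P ts, σ => .atom P (fun i => (ts i).subst σ)
  | .bot, _ => .bot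
  | .imp A B, σ => .imp (A.subst σ) (B.subst σ)
  | .and A B, σ => .and (A.subst σ) (B.subst σ)
  | .or A B, σ => .or (A.subst σ) (B.subst σ)
  | .all A, σ => .all (A.subst (up σ))
  | .ex A, σ => .ex (A.subst (up σ))

/-- If `A` is the body of a quantifier binding `x`, then `A.inst t` is `[t/x]A`. -/
def Formula.inst (A : Formula L) (t : L.Term ℕ) : Formula L :=
  A.subst (fun k => match k with
    | 0 => t
    | j + 1 => FirstOrder.Language.Term.var j)

/-- The proposition `A`, moved to a context with a new variable `0`, which is not free in it. -/
def Formula.shift (A : Formula L) : Formula L :=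
  A.subst (fun k => FirstOrder.Language.Term.var (k + 1))

/-! ## Rewriting -/

/-- A rewrite system on the terms of `L`: a set of rules `l → r` whose left-hand side `l` is not
a variable. -/
structure RewriteSystem (L : FirstOrder.Language.{u, v}) where
  rules : Set (L.Term ℕ × L.Term ℕ)
  lhs_not_var : ∀ p ∈ rules, ∀ x : ℕ, p.1 ≠ FirstOrder.Language.Term.var x

/-- One-step rewriting of terms. -/
inductive TermStep (R : RewriteSystem L) : L.Term ℕ → L.Term ℕ → Prop
  | rule {l r : L.Term ℕ} (h : (l, r) ∈ R.rules) (θ : ℕ → L.Term ℕ) :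
      TermStep R (l.subst θ) (r.subst θ)
  | func {n : ℕ} (f : L.Functions n) (ts : Fin n → L.Term ℕ) (i : Fin n) {t : L.Term ℕ}
      (h : TermStep R (ts i) t) :
      TermStep R (FirstOrder.Language.Term.func f ts) (FirstOrder.Language.Term.func f (Function.update ts i t))

/-- One-step rewriting of propositions: one step on a term that occurs in the proposition. -/
inductive Step (R : RewriteSystem L) : Formula L → Formula L → Prop
  | atom {n : ℕ} (P : L.Relations n) (ts : Fin n → L.Term ℕ) (i : Fin n) {t : L.Term ℕ}
      (h : TermStep R (ts i) t) :
      Step R (.atom P ts) (.atom P (Function.update ts i t))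
  | imp_left {A A' : Formula L} (B : Formula L) (h : Step R A A') :
      Step R (.imp A B) (.imp A' B)
  | imp_right (A : Formula L) {B B' : Formula L} (h : Step R B B') :
      Step R (.imp A B) (.imp A B')
  | and_left {A A' : Formula L} (B : Formula L) (h : Step R A A') :
      Step R (.and A B) (.and A' B)
  | and_right (A : Formula L) {B B' : Formula L} (h : Step R B B') :
      Step R (.and A B) (.and A B')
  | or_left {A A' : Formula L} (B : Formula L) (h : Step R A A') :
      Step R (.or A B) (.or A' B)
  | or_right (A : Formula L) {B B' : Formula L} (h : Step R B B') :
      Step R (.or A B) (.or A B')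
  | all {A A' : Formula L} (h : Step R A A') : Step R (.all A) (.all A')
  | ex {A A' : Formula L} (h : Step R A A') : Step R (.ex A) (.ex A')

/-- Rewriting of terms in any number of steps. -/
def TermRed (R : RewriteSystem L) : L.Term ℕ → L.Term ℕ → Prop :=
  Relation.ReflTransGen (TermStep R)

/-- Rewriting of propositions in any number of steps. -/
def Red (R : RewriteSystem L) : Formula L → Formula L → Prop :=
  Relation.ReflTransGen (Step R)

/-- The rewrite system is confluent: any two reducts of a term have a common reduct. -/
def RewriteSystem.Confluent (R : RewriteSystem L) : Prop :=
  ∀ t t₁ t₂ : L.Term ℕ, TermRed R t t₁ → TermRed R t t₂ →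
    ∃ s : L.Term ℕ, TermRed R t₁ s ∧ TermRed R t₂ s

/-! ## Asymmetric sequent calculus modulo -/

/-- `Provable R cut Γ Δ`: the sequent `Γ ⊢ Δ` has a proof in asymmetric sequent calculus modulo
`R`. The cut rule may be used in the proof if `cut = true`; the proof is cut free if
`cut = false`. All other rules do not depend on `cut`.

In `all_right` and `ex_left` the eigenvariable is the variable `0`: it is not free in the
shifted side propositions. -/
inductive Provable (R : RewriteSystem L) (cut : Bool) :
    Multiset (Formula L) → Multiset (Formula L) → Prop
  | ax {Γ Δ : Multiset (Formula L)} {A A₁ A₂ : Formula L}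
      (h₁ : Red R A₁ A) (h₂ : Red R A₂ A) :
      Provable R cut (A₁ ::ₘ Γ) (A₂ ::ₘ Δ)
  | cut_rule {Γ Δ : Multiset (Formula L)} {C C₁ C₂ : Formula L} (hcut : cut = true)
      (h₁ : Red R C C₁) (h₂ : Red R C C₂)
      (p₁ : Provable R cut Γ (C₁ ::ₘ Δ)) (p₂ : Provable R cut (C₂ ::ₘ Γ) Δ) :
      Provable R cut Γ Δ
  | contr_left {Γ Δ : Multiset (Formula L)} {A A₁ A₂ : Formula L}
      (h₁ : Red R A A₁) (h₂ : Red R A A₂)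
      (p : Provable R cut (A₁ ::ₘ A₂ ::ₘ Γ) Δ) :
      Provable R cut (A ::ₘ Γ) Δ
  | contr_right {Γ Δ : Multiset (Formula L)} {A A₁ A₂ : Formula L}
      (h₁ : Red R A A₁) (h₂ : Red R A A₂)
      (p : Provable R cut Γ (A₁ ::ₘ A₂ ::ₘ Δ)) :
      Provable R cut Γ (A ::ₘ Δ)
  | weak_left {Γ Δ : Multiset (Formula L)} {A : Formula L} (p : Provable R cut Γ Δ) :
      Provable R cut (A ::ₘ Γ) Δ
  | weak_right {Γ Δ : Multiset (Formula L)} {A : Formula L} (p : Provable R cut Γ Δ) :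
      Provable R cut Γ (A ::ₘ Δ)
  | imp_left {Γ Δ : Multiset (Formula L)} {A B C : Formula L} (h : Red R C (.imp A B))
      (p₁ : Provable R cut Γ (A ::ₘ Δ)) (p₂ : Provable R cut (B ::ₘ Γ) Δ) :
      Provable R cut (C ::ₘ Γ) Δ
  | imp_right {Γ Δ : Multiset (Formula L)} {A B C : Formula L} (h : Red R C (.imp A B))
      (p : Provable R cut (A ::ₘ Γ) (B ::ₘ Δ)) :
      Provable R cut Γ (C ::ₘ Δ)
  | and_left {Γ Δ : Multiset (Formula L)} {A B C : Formula L} (h : Red R C (.and A B))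
      (p : Provable R cut (A ::ₘ B ::ₘ Γ) Δ) :
      Provable R cut (C ::ₘ Γ) Δ
  | and_right {Γ Δ : Multiset (Formula L)} {A B C : Formula L} (h : Red R C (.and A B))
      (p₁ : Provable R cut Γ (A ::ₘ Δ)) (p₂ : Provable R cut Γ (B ::ₘ Δ)) :
      Provable R cut Γ (C ::ₘ Δ)
  | or_left {Γ Δ : Multiset (Formula L)} {A B C : Formula L} (h : Red R C (.or A B))
      (p₁ : Provable R cut (A ::ₘ Γ) Δ) (p₂ : Provable R cut (B ::ₘ Γ) Δ) :
      Provable R cut (C ::ₘ Γ) Δ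
  | or_right {Γ Δ : Multiset (Formula L)} {A B C : Formula L} (h : Red R C (.or A B))
      (p : Provable R cut Γ (A ::ₘ B ::ₘ Δ)) :
      Provable R cut Γ (C ::ₘ Δ)
  | bot_left {Γ Δ : Multiset (Formula L)} {A : Formula L} (h : Red R A .bot) :
      Provable R cut (A ::ₘ Γ) Δ
  | all_left {Γ Δ : Multiset (Formula L)} {A B : Formula L} (t : L.Term ℕ)
      (h : Red R B (.all A)) (p : Provable R cut (A.inst t ::ₘ Γ) Δ) :
      Provable R cut (B ::ₘ Γ) Δ
  | all_right {Γ Δ : Multiset (Formula L)} {A B : Formula L} (h : Red R B (.all A))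
      (p : Provable R cut (Γ.map Formula.shift) (A ::ₘ Δ.map Formula.shift)) :
      Provable R cut Γ (B ::ₘ Δ)
  | ex_left {Γ Δ : Multiset (Formula L)} {A B : Formula L} (h : Red R B (.ex A))
      (p : Provable R cut (A ::ₘ Γ.map Formula.shift) (Δ.map Formula.shift)) :
      Provable R cut (B ::ₘ Γ) Δ
  | ex_right {Γ Δ : Multiset (Formula L)} {A B : Formula L} (t : L.Term ℕ)
      (h : Red R B (.ex A)) (p : Provable R cut Γ (A.inst t ::ₘ Δ)) :
      Provable R cut Γ (B ::ₘ Δ)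

/-- The cut rule is redundant: every provable sequent has a cut-free proof. -/
def CutRedundant (R : RewriteSystem L) : Prop :=
  ∀ Γ Δ : Multiset (Formula L), Provable R true Γ Δ → Provable R false Γ Δ

end AsymmetricModulo

/-!
If cuts are redundant, a peak `t₁ ←* t →* t₂` yields the cut-free provable sequent
`P(t₁) ⊢ P(t₂)`, where `P` has positive arity. All propositions of a cut-free proof of it are
reducts of one of the two atoms, so its only leaf is an axiom, which gives a common reduct.

Conversely, interpret propositions in the complete Boolean algebra of facts of the phase semantics
whose pole is the set of cut-free provable sequents. Let `l A` and `r A` be the facts of all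
sequents that become cut-free provable when `A` is added on the left, respectively on the right.
The cut-free rules say exactly that `l` and `r` are compatible with the connectives in such a way
that `⟦A⟧ᶜ ≤ l A` and `⟦A⟧ ≤ r A` follow by induction on `A`. The calculus with cut is sound for
any Boolean-valued interpretation that is invariant under rewriting. Confluence is what makes
joinability of atoms transitive, so that `⟦A⟧ = ⨅ B, r B`, over the `B` joinable with the atom `A`,
is such an interpretation. Then `Γ ⊢ Δ` gives
`⊤ ≤ (⨅ A ∈ Γ, ⟦A⟧)ᶜ ⊔ ⨆ A ∈ Δ, ⟦A⟧ ≤ (⨆ A ∈ Γ, l A) ⊔ ⨆ A ∈ Δ, r A`, and the right-hand side is the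
fact of the contexts in which `Γ ⊢ Δ` is cut-free provable.
-/

namespace AsymmetricModulo

open FirstOrder.Language Filter

/-! ## The Boolean algebra of facts -/

section Phase

variable {M : Type*}

/-- A set of elements of a commutative semigroup closed under weakening and contraction, such as
the set of provable sequents of a classical sequent calculus. -/
class IsPole [AddCommSemigroup M] (S : Set M) : Prop where
  add_mem : ∀ {m : M}, m ∈ S → ∀ n : M, m + n ∈ S
  mem_of_add_self_mem : ∀ {m : M}, m + m ∈ S → m ∈ S

/-- Orthogonality of phase semantics with respect to the pole `S`. -/
def Orthogonal [Add M] (S : Set M) (m n : M) : Prop := m + n ∈ S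

/-- The facts of phase semantics with respect to the pole `S`: pairs of subsets of `M` that are
the orthogonals of each other. They are encoded as the formal concepts of orthogonality, whose
complete lattice structure they inherit. -/
abbrev PhaseFact [Add M] (S : Set M) : Type _ := Concept M M (Orthogonal S)

/-- The fact whose extent is the orthogonal of `m`. If `m` is a sequent and `S` the set of provable
ones, these are the contexts in which `m` is provable. -/
def polar [Add M] (S : Set M) (m : M) : PhaseFact S := Concept.ofAttribute (Orthogonal S) m

theorem mem_extent_polar [Add M] {S : Set M} {m n : M} : m ∈ (polar S n).extent ↔ m + n ∈ S :=
  mem_lowerPolar_singleton _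

theorem IsPole.add_mem_of_add_add_self_mem [AddCommSemigroup M] {S : Set M} [IsPole S] {m n : M}
    (h : m + n + n ∈ S) : m + n ∈ S :=
  mem_of_add_self_mem <| by
    rw [show m + n + (m + n) = m + n + n + m by ac_rfl]
    exact add_mem h m

namespace PhaseFact

theorem mem_extent_iff [Add M] {S : Set M} {X : PhaseFact S} {m : M} :
    m ∈ X.extent ↔ ∀ n ∈ X.intent, m + n ∈ S := by
  rw [← X.lowerPolar_intent]
  rfl

theorem mem_intent_iff [Add M] {S : Set M} {X : PhaseFact S} {n : M} :
    n ∈ X.intent ↔ ∀ m ∈ X.extent, m + n ∈ S := by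
  rw [← X.upperPolar_extent]
  rfl

/-- Complementation of facts, which swaps the extent and the intent. -/
instance [AddCommMagma M] {S : Set M} : Compl (PhaseFact S) where
  compl X :=
    { extent := X.intent
      intent := X.extent
      upperPolar_extent := by
        ext m
        simp only [mem_upperPolar_iff, Orthogonal, mem_extent_iff, add_comm m]
      lowerPolar_intent := by
        ext n
        simp only [mem_lowerPolar_iff, Orthogonal, mem_intent_iff, add_comm n] }

variable [AddCommSemigroup M] {S : Set M} [IsPole S] {X : PhaseFact S} {m n : M}

theorem add_mem_extent (hm : m ∈ X.extent) (n : M) : m + n ∈ X.extent :=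
  mem_extent_iff.2 fun k hk => by
    rw [add_right_comm]
    exact IsPole.add_mem (mem_extent_iff.1 hm k hk) n

theorem inf_compl_le_bot (X : PhaseFact S) : X ⊓ Xᶜ ≤ ⊥ := by
  rintro m ⟨hX, hXc⟩
  have hm : m ∈ S := IsPole.mem_of_add_self_mem (mem_extent_iff.1 hX m hXc)
  exact mem_extent_iff.2 fun n _ => IsPole.add_mem hm n

theorem top_le_sup_compl (X : PhaseFact S) : ⊤ ≤ X ⊔ Xᶜ := by
  refine fun m _ => mem_extent_iff.2 fun n ⟨hX, hXc⟩ => ?_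
  have hn : n ∈ S := IsPole.mem_of_add_self_mem (mem_extent_iff.1 hXc n hX)
  rw [add_comm]
  exact IsPole.add_mem hn m

theorem add_mem_intent_of_mem_intent_inf {Y : PhaseFact S} (hm : m ∈ X.extent)
    (hn : n ∈ (X ⊓ Y).intent) : m + n ∈ Y.intent :=
  mem_intent_iff.2 fun k hk => by
    have hmk : m + k ∈ (X ⊓ Y).extent := ⟨add_mem_extent hm k, add_comm k m ▸ add_mem_extent hk m⟩
    rw [← add_assoc, add_comm k]
    exact mem_intent_iff.1 hn _ hmk

theorem inf_sup_le (X Y Z : PhaseFact S) : X ⊓ (Y ⊔ Z) ≤ X ⊓ Y ⊔ X ⊓ Z := by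
  rintro m ⟨hX, hYZ⟩
  refine mem_extent_iff.2 fun n ⟨hY, hZ⟩ => ?_
  have hmmn : m + (m + n) ∈ S := mem_extent_iff.1 hYZ _
    ⟨add_mem_intent_of_mem_intent_inf hX hY, add_mem_intent_of_mem_intent_inf hX hZ⟩
  rw [add_comm m n]
  apply IsPole.add_mem_of_add_add_self_mem
  rwa [show n + m + m = m + (m + n) by ac_rfl]

instance : CompleteBooleanAlgebra (PhaseFact S) where
  __ := DistribLattice.ofInfSupLe inf_sup_le
  __ := (inferInstance : CompleteLattice (PhaseFact S))
  inf_compl_le_bot := inf_compl_le_bot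
  top_le_sup_compl := top_le_sup_compl

end PhaseFact

theorem polar_add [AddCommSemigroup M] {S : Set M} [IsPole S] (m n : M) :
    polar S (m + n) = polar S m ⊔ polar S n := by
  refine le_antisymm (fun k hk => ?_) (sup_le (fun k hk => ?_) fun k hk => ?_)
  · refine PhaseFact.mem_extent_iff.2 fun a ⟨ham, han⟩ => ?_
    have hkm : k + m ∈ (polar S n).extent := by
      rwa [mem_extent_polar, add_assoc, ← mem_extent_polar]
    have hka : k + a ∈ (polar S m).extent := by
      rw [mem_extent_polar, add_right_comm]
      exact PhaseFact.mem_intent_iff.1 han _ hkm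
    exact IsPole.add_mem_of_add_add_self_mem (PhaseFact.mem_intent_iff.1 ham _ hka)
  · rw [mem_extent_polar] at hk ⊢
    rw [← add_assoc]
    exact IsPole.add_mem hk n
  · rw [mem_extent_polar] at hk ⊢
    rw [add_comm m, ← add_assoc]
    exact IsPole.add_mem hk m

theorem mem_extent_polar_sup_polar [AddCommSemigroup M] {S : Set M} [IsPole S] {k m n : M} :
    k ∈ (polar S m ⊔ polar S n).extent ↔ k + (m + n) ∈ S := by
  rw [← polar_add, mem_extent_polar]

theorem mem_of_polar_eq_top [AddZeroClass M] {S : Set M} {m : M} (h : polar S m = ⊤) : m ∈ S := by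
  have : 0 ∈ (polar S m).extent := h ▸ Set.mem_univ 0
  rwa [mem_extent_polar, zero_add] at this

end Phase

/-! ## Substitutions -/

variable {L : FirstOrder.Language.{u, v}}

theorem term_subst_subst {α β γ : Type*} (t : L.Term α) (σ : α → L.Term β) (τ : β → L.Term γ) :
    (t.subst σ).subst τ = t.subst fun k => (σ k).subst τ := by
  induction t with
  | var x => rfl
  | func f ts ih => simp only [Term.subst, ih]

theorem term_subst_var {α : Type*} (t : L.Term α) : t.subst Term.var = t := by
  induction t with
  | var x => rfl
  | func f ts ih => simp only [Term.subst, ih]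

theorem term_relabel_eq_subst {α β : Type*} (t : L.Term α) (g : α → β) :
    t.relabel g = t.subst fun k => Term.var (g k) := by
  induction t with
  | var x => rfl
  | func f ts ih => simp only [Term.subst, Term.relabel, ih]

/-- The substitution that sends the variable `0` to `t` and the variable `k + 1` to `σ k`; it
interprets the body of a quantifier when the bound variable stands for `t`. -/
def scons (t : L.Term ℕ) (σ : ℕ → L.Term ℕ) : ℕ → L.Term ℕ
  | 0 => t
  | k + 1 => σ k

theorem scons_subst (t : L.Term ℕ) (σ τ : ℕ → L.Term ℕ) :
    (fun k => (scons t σ k).subst τ) = scons (t.subst τ) fun k => (σ k).subst τ := by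
  funext k
  cases k <;> rfl

theorem up_subst_scons (σ τ : ℕ → L.Term ℕ) (t : L.Term ℕ) :
    (fun k => (up σ k).subst (scons t τ)) = scons t fun k => (σ k).subst τ := by
  funext k
  cases k with
  | zero => rfl
  | succ k => simp only [up, term_relabel_eq_subst, term_subst_subst, Term.subst, scons]

theorem up_subst_up (σ τ : ℕ → L.Term ℕ) :
    (fun k => (up σ k).subst (up τ)) = up fun k => (σ k).subst τ := by
  funext k
  cases k with
  | zero => rfl
  | succ k => simp only [up, term_relabel_eq_subst, term_subst_subst, Term.subst]

theorem up_var : up (Term.var : ℕ → L.Term ℕ) = Term.var := by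
  funext k
  cases k <;> rfl

theorem eqOn_up {N : ℕ} {σ τ : ℕ → L.Term ℕ} (h : Set.EqOn σ τ (Set.Iio N)) :
    Set.EqOn (up σ) (up τ) (Set.Iio N) := by
  intro k hk
  cases k with
  | zero => rfl
  | succ k => simp only [up, h (Nat.lt_of_succ_lt hk)]

theorem term_eventually_subst_congr (t : L.Term ℕ) :
    ∀ᶠ N in atTop, ∀ σ τ : ℕ → L.Term ℕ, Set.EqOn σ τ (Set.Iio N) → t.subst σ = t.subst τ := by
  induction t with
  | var x => exact (eventually_gt_atTop x).mono fun N hN σ τ h => h hN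
  | func f ts ih =>
    filter_upwards [eventually_all.2 ih] with N hN σ τ h
    simp only [Term.subst, fun i => hN i σ τ h]

namespace Formula

theorem subst_subst (A : Formula L) (σ τ : ℕ → L.Term ℕ) :
    (A.subst σ).subst τ = A.subst fun k => (σ k).subst τ := by
  induction A generalizing σ τ with
  | atom P ts => simp only [subst, term_subst_subst]
  | bot => rfl
  | imp A B ihA ihB | and A B ihA ihB | or A B ihA ihB => simp only [subst, ihA, ihB]
  | all A ih | ex A ih => simp only [subst, ih, up_subst_up]

theorem subst_var (A : Formula L) : A.subst Term.var = A := by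
  induction A with
  | atom P ts => simp only [subst, term_subst_var]
  | bot => rfl
  | imp A B ihA ihB | and A B ihA ihB | or A B ihA ihB => simp only [subst, ihA, ihB]
  | all A ih | ex A ih => simp only [subst, up_var, ih]

theorem inst_eq_subst (A : Formula L) (t : L.Term ℕ) : A.inst t = A.subst (scons t Term.var) := by
  rw [inst]
  congr 1

theorem inst_subst (A : Formula L) (t : L.Term ℕ) (σ : ℕ → L.Term ℕ) :
    (A.inst t).subst σ = A.subst (scons (t.subst σ) σ) := by
  rw [inst_eq_subst, subst_subst, scons_subst]
  rfl

theorem subst_up_inst (A : Formula L) (t : L.Term ℕ) (σ : ℕ → L.Term ℕ) :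
    (A.subst (up σ)).inst t = A.subst (scons t σ) := by
  simp only [inst_eq_subst, subst_subst, up_subst_scons, term_subst_var]

theorem shift_subst_up (A : Formula L) (σ : ℕ → L.Term ℕ) :
    A.shift.subst (up σ) = (A.subst σ).shift := by
  simp only [shift, subst_subst, Term.subst, up, term_relabel_eq_subst]

theorem map_shift_map_subst_up (Γ : Multiset (Formula L)) (σ : ℕ → L.Term ℕ) :
    (Γ.map shift).map (subst · (up σ)) = (Γ.map (subst · σ)).map shift := by
  simp only [Multiset.map_map, Function.comp_def, shift_subst_up]

theorem eventually_subst_congr (A : Formula L) :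
    ∀ᶠ N in atTop, ∀ σ τ : ℕ → L.Term ℕ, Set.EqOn σ τ (Set.Iio N) → A.subst σ = A.subst τ := by
  induction A with
  | atom P ts =>
    filter_upwards [eventually_all.2 fun i => term_eventually_subst_congr (ts i)] with N hN σ τ h
    simp only [subst, fun i => hN i σ τ h]
  | bot => exact .of_forall fun _ _ _ _ => rfl
  | imp A B ihA ihB | and A B ihA ihB | or A B ihA ihB =>
    filter_upwards [ihA, ihB] with N hA hB σ τ h
    simp only [subst, hA σ τ h, hB σ τ h]
  | all A ih | ex A ih =>
    filter_upwards [ih] with N hN σ τ h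
    simp only [subst, hN _ _ (eqOn_up h)]

end Formula

/-- The renaming that turns the variable `N`, assumed to be fresh, into the bound variable `0` of a
quantifier and moves the other variables into the context of this quantifier. -/
def bindVar (N : ℕ) : ℕ → L.Term ℕ := fun k => if k = N then Term.var 0 else Term.var (k + 1)

theorem Formula.eventually_map_subst_bindVar (Γ : Multiset (Formula L)) :
    ∀ᶠ N in atTop, Γ.map (subst · (bindVar N)) = Γ.map shift := by
  induction Γ using Multiset.induction with
  | empty => exact .of_forall fun _ => rfl
  | cons A Γ ih =>
    filter_upwards [ih, A.eventually_subst_congr] with N hΓ hA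
    have hA : A.subst (bindVar N) = A.shift := hA _ _ fun k hk => if_neg (ne_of_lt hk)
    rw [Multiset.map_cons, Multiset.map_cons, hΓ, hA]

theorem Formula.eventually_inst_var_subst_bindVar (A : Formula L) :
    ∀ᶠ N in atTop, (A.inst (Term.var N)).subst (bindVar N) = A := by
  filter_upwards [A.eventually_subst_congr] with N hA
  rw [inst_subst]
  conv_rhs => rw [← A.subst_var]
  refine hA _ _ fun k hk => ?_
  cases k with
  | zero => exact if_pos rfl
  | succ k => exact if_neg (Nat.lt_of_succ_lt hk).ne

/-! ## Rewriting -/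

variable {R : RewriteSystem L}

theorem update_subst {n : ℕ} (ts : Fin n → L.Term ℕ) (i : Fin n) (t : L.Term ℕ)
    (σ : ℕ → L.Term ℕ) :
    (fun j => (Function.update ts i t j).subst σ) =
      Function.update (fun j => (ts j).subst σ) i (t.subst σ) :=
  funext fun j => Function.apply_update (fun _ s => s.subst σ) ts i t j

theorem TermStep.subst {s t : L.Term ℕ} (h : TermStep R s t) (σ : ℕ → L.Term ℕ) :
    TermStep R (s.subst σ) (t.subst σ) := by
  induction h with
  | rule h θ =>
    rw [term_subst_subst, term_subst_subst]
    exact .rule h _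
  | func f ts i _ ih =>
    simp only [Term.subst, update_subst]
    exact .func f _ i ih

theorem Step.subst {A B : Formula L} (h : Step R A B) (σ : ℕ → L.Term ℕ) :
    Step R (A.subst σ) (B.subst σ) := by
  induction h generalizing σ with
  | atom P ts i h =>
    simp only [Formula.subst, update_subst]
    exact .atom P _ i (h.subst σ)
  | imp_left B _ ih => exact .imp_left _ (ih σ)
  | imp_right A _ ih => exact .imp_right _ (ih σ)
  | and_left B _ ih => exact .and_left _ (ih σ)
  | and_right A _ ih => exact .and_right _ (ih σ)
  | or_left B _ ih => exact .or_left _ (ih σ)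
  | or_right A _ ih => exact .or_right _ (ih σ)
  | all _ ih => exact .all (ih _)
  | ex _ ih => exact .ex (ih _)

namespace Red

theorem refl (A : Formula L) : Red R A A := Relation.ReflTransGen.refl

theorem subst {A B : Formula L} (h : Red R A B) (σ : ℕ → L.Term ℕ) :
    Red R (A.subst σ) (B.subst σ) :=
  Relation.ReflTransGen.lift (Formula.subst · σ) (fun _ _ h => Step.subst h σ) _ _ h

variable {n : ℕ} {P : L.Relations n} {ts us : Fin n → L.Term ℕ}

theorem atom_update (P : L.Relations n) (ts : Fin n → L.Term ℕ) (i : Fin n) {t : L.Term ℕ}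
    (h : TermRed R (ts i) t) : Red R (.atom P ts) (.atom P (Function.update ts i t)) := by
  induction h with
  | refl =>
    rw [Function.update_eq_self]
    exact refl _
  | @tail s t _ hst ih =>
    have hstep := Step.atom P (Function.update ts i s) i (by rwa [Function.update_self])
    rw [Function.update_idem] at hstep
    exact ih.tail hstep

theorem atom (P : L.Relations n) (h : ∀ i, TermRed R (ts i) (us i)) :
    Red R (.atom P ts) (.atom P us) := by
  suffices ∀ s : Finset (Fin n), Red R (.atom P ts) (.atom P (s.piecewise us ts)) by
    simpa only [Finset.piecewise_univ] using this Finset.univ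
  intro s
  induction s using Finset.induction_on with
  | empty =>
    rw [Finset.piecewise_empty]
    exact refl _
  | insert i s hi ih =>
    rw [Finset.piecewise_insert]
    refine Relation.ReflTransGen.trans ih (atom_update P _ i ?_)
    rw [Finset.piecewise_eq_of_notMem _ _ _ hi]
    exact h i

theorem exists_eq_atom {B : Formula L} (h : Red R (.atom P ts) B) :
    ∃ us, B = .atom P us ∧ ∀ i, TermRed R (ts i) (us i) := by
  induction h with
  | refl => exact ⟨ts, rfl, fun _ => .refl⟩
  | tail _ hs ih =>
    obtain ⟨us, rfl, hus⟩ := ih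
    cases hs with
    | atom _ _ i h =>
      refine ⟨_, rfl, fun j => ?_⟩
      obtain rfl | hj := eq_or_ne j i
      · rw [Function.update_self]
        exact (hus j).tail h
      · rw [Function.update_of_ne hj]
        exact hus j

end Red

theorem RewriteSystem.Confluent.join_of_red_atom (hR : R.Confluent) {n : ℕ} {P : L.Relations n}
    {ts : Fin n → L.Term ℕ} {B C : Formula L} (hB : Red R (.atom P ts) B)
    (hC : Red R (.atom P ts) C) : Relation.Join (Red R) B C := by
  obtain ⟨us, rfl, hus⟩ := hB.exists_eq_atom
  obtain ⟨vs, rfl, hvs⟩ := hC.exists_eq_atom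
  choose ws husw hvsw using fun i => hR _ _ _ (hus i) (hvs i)
  exact ⟨.atom P ws, Red.atom P husw, Red.atom P hvsw⟩

theorem RewriteSystem.Confluent.join_step_atom_iff (hR : R.Confluent) {n : ℕ} {P : L.Relations n}
    {ts us : Fin n → L.Term ℕ} (h : Step R (.atom P ts) (.atom P us)) (B : Formula L) :
    Relation.Join (Red R) (.atom P ts) B ↔ Relation.Join (Red R) (.atom P us) B := by
  constructor
  · rintro ⟨C, hC, hBC⟩
    obtain ⟨D, hD, hCD⟩ := hR.join_of_red_atom (.single h) hC
    exact ⟨D, hD, hBC.trans hCD⟩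
  · rintro ⟨C, hC, hBC⟩
    exact ⟨C, hC.head h, hBC⟩

/-! ## Confluence from redundancy of cuts -/

theorem Provable.join_of_reducts_of_atoms {n k : ℕ} {P : L.Relations n} {Q : L.Relations k}
    {ts : Fin n → L.Term ℕ} {us : Fin k → L.Term ℕ} {Γ Δ : Multiset (Formula L)}
    (p : Provable R false Γ Δ) (hΓ : ∀ A ∈ Γ, Red R (.atom P ts) A)
    (hΔ : ∀ A ∈ Δ, Red R (.atom Q us) A) :
    Relation.Join (Red R) (.atom P ts) (.atom Q us) := by
  induction p with simp only [Multiset.forall_mem_cons] at *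
  | ax h₁ h₂ => exact ⟨_, hΓ.1.trans h₁, hΔ.1.trans h₂⟩
  | cut_rule hcut => exact absurd hcut Bool.false_ne_true
  | contr_left h₁ h₂ _ ih => exact ih ⟨hΓ.1.trans h₁, hΓ.1.trans h₂, hΓ.2⟩ hΔ
  | contr_right h₁ h₂ _ ih => exact ih hΓ ⟨hΔ.1.trans h₁, hΔ.1.trans h₂, hΔ.2⟩
  | weak_left _ ih => exact ih hΓ.2 hΔ
  | weak_right _ ih => exact ih hΓ hΔ.2
  | imp_left h | and_left h | or_left h | bot_left h | all_left _ h | ex_left h =>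
    obtain ⟨_, ⟨⟩, _⟩ := Red.exists_eq_atom (hΓ.1.trans h)
  | imp_right h | and_right h | or_right h | all_right h | ex_right _ h =>
    obtain ⟨_, ⟨⟩, _⟩ := Red.exists_eq_atom (hΔ.1.trans h)

theorem CutRedundant.confluent {n : ℕ} (P : L.Relations (n + 1)) (h : CutRedundant R) :
    R.Confluent := by
  intro t t₁ t₂ h₁ h₂
  have hcut : Provable R true {.atom P fun _ => t₁} {.atom P fun _ => t₂} :=
    .cut_rule rfl (Red.atom P fun _ => h₁) (Red.atom P fun _ => h₂)
      (.ax (Red.refl _) (Red.refl _)) (.ax (Red.refl _) (Red.refl _))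
  obtain ⟨A, hA₁, hA₂⟩ := (h _ _ hcut).join_of_reducts_of_atoms (P := P) (Q := P)
    (ts := fun _ => t₁) (us := fun _ => t₂) (by simp [Red.refl]) (by simp [Red.refl])
  obtain ⟨us, rfl, hus⟩ := hA₁.exists_eq_atom
  obtain ⟨vs, hvs_eq, hvs⟩ := hA₂.exists_eq_atom
  cases hvs_eq
  exact ⟨us 0, hus 0, hvs 0⟩

/-! ## Boolean-valued soundness -/

theorem le_of_le_sup_of_inf_le {α : Type*} [DistribLattice α] {a b c : α}
    (h₁ : a ≤ c ⊔ b) (h₂ : c ⊓ a ≤ b) : a ≤ b :=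
  le_of_inf_le_sup_le (z := c) (le_inf (inf_comm a c ▸ h₂) inf_le_right)
    (sup_le (sup_comm b c ▸ h₁) le_sup_right)

theorem himp_inf_le_of_le_sup_of_inf_le {α : Type*} [GeneralizedHeytingAlgebra α] {a b c d : α}
    (h₁ : c ≤ a ⊔ d) (h₂ : b ⊓ c ≤ d) : (a ⇨ b) ⊓ c ≤ d := by
  refine le_of_le_sup_of_inf_le (inf_le_right.trans h₁) ?_
  rw [← inf_assoc]
  exact (inf_le_inf_right _ inf_himp_le).trans h₂

theorem le_himp_sup_of_inf_le_sup {α : Type*} [BooleanAlgebra α] {a b c d : α}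
    (h : a ⊓ c ≤ b ⊔ d) : c ≤ (a ⇨ b) ⊔ d := by
  rwa [himp_eq, sup_right_comm, ← himp_eq, le_himp_iff']

section Value

variable {B : Type*} [Order.Frame B]

/-- A valuation of the atomic propositions in `B`, over the domain of terms. -/
abbrev AtomValuation (L : FirstOrder.Language.{u, v}) (B : Type*) : Type _ :=
  ∀ ⦃n : ℕ⦄, L.Relations n → (Fin n → L.Term ℕ) → B

/-- The value in a frame of a proposition whose variables are interpreted by the terms `σ`. -/
def value (V : AtomValuation L B) : Formula L → (ℕ → L.Term ℕ) → B
  | .atom P ts, σ => V P fun i => (ts i).subst σ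
  | .bot, _ => ⊥
  | .imp A B, σ => value V A σ ⇨ value V B σ
  | .and A B, σ => value V A σ ⊓ value V B σ
  | .or A B, σ => value V A σ ⊔ value V B σ
  | .all A, σ => ⨅ t, value V A (scons t σ)
  | .ex A, σ => ⨆ t, value V A (scons t σ)

variable {V : AtomValuation L B}

theorem value_subst (A : Formula L) (σ τ : ℕ → L.Term ℕ) :
    value V (A.subst σ) τ = value V A fun k => (σ k).subst τ := by
  induction A generalizing σ τ with
  | atom P ts => simp only [Formula.subst, value, term_subst_subst]
  | bot => rfl
  | imp A B ihA ihB | and A B ihA ihB | or A B ihA ihB => simp only [Formula.subst, value, ihA, ihB]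
  | all A ih | ex A ih => simp only [Formula.subst, value, ih, up_subst_scons]

theorem value_inst (A : Formula L) (t : L.Term ℕ) (σ : ℕ → L.Term ℕ) :
    value V (A.inst t) σ = value V A (scons (t.subst σ) σ) := by
  rw [Formula.inst_eq_subst, value_subst, scons_subst]
  rfl

theorem value_all_le_value_inst (A : Formula L) (t : L.Term ℕ) (σ : ℕ → L.Term ℕ) :
    value V (.all A) σ ≤ value V (A.inst t) σ := by
  rw [value_inst]
  exact iInf_le (fun s => value V A (scons s σ)) _

theorem value_inst_le_value_ex (A : Formula L) (t : L.Term ℕ) (σ : ℕ → L.Term ℕ) :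
    value V (A.inst t) σ ≤ value V (.ex A) σ := by
  rw [value_inst]
  exact le_iSup (fun s => value V A (scons s σ)) _

theorem map_value_map_shift (Γ : Multiset (Formula L)) (t : L.Term ℕ) (σ : ℕ → L.Term ℕ) :
    (Γ.map Formula.shift).map (value V · (scons t σ)) = Γ.map (value V · σ) := by
  rw [Multiset.map_map]
  exact Multiset.map_congr rfl fun A _ => value_subst A _ _

/-- Invariance of a valuation of the atomic propositions under rewriting. -/
def AtomValuation.RewriteInvariant {B : Type*} (R : RewriteSystem L) (V : AtomValuation L B) :
    Prop :=
  ∀ ⦃n : ℕ⦄ ⦃P : L.Relations n⦄ ⦃ts us : Fin n → L.Term ℕ⦄,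
    Step R (.atom P ts) (.atom P us) → V P ts = V P us

namespace AtomValuation.RewriteInvariant

variable (hV : V.RewriteInvariant R)

include hV

theorem value_eq_of_step {A A' : Formula L} (h : Step R A A') (σ : ℕ → L.Term ℕ) :
    value V A σ = value V A' σ := by
  induction h generalizing σ with
  | atom P ts i h => exact hV ((Step.atom P ts i h).subst σ)
  | imp_left _ _ ih | imp_right _ _ ih | and_left _ _ ih | and_right _ _ ih | or_left _ _ ih
  | or_right _ _ ih | all _ ih | ex _ ih => simp only [value, ih]

theorem value_eq_of_red {A A' : Formula L} (h : Red R A A') (σ : ℕ → L.Term ℕ) :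
    value V A σ = value V A' σ := by
  induction h with
  | refl => rfl
  | tail _ h ih => exact ih.trans (hV.value_eq_of_step h σ)

end AtomValuation.RewriteInvariant

end Value

theorem Provable.inf_value_le_sup_value {B : Type*} [CompleteBooleanAlgebra B]
    {V : AtomValuation L B} (hV : V.RewriteInvariant R) {cut : Bool}
    {Γ Δ : Multiset (Formula L)} (p : Provable R cut Γ Δ) (σ : ℕ → L.Term ℕ) :
    (Γ.map (value V · σ)).inf ≤ (Δ.map (value V · σ)).sup := by
  induction p generalizing σ
    with simp only [Multiset.map_cons, Multiset.inf_cons, Multiset.sup_cons] at *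
  | ax h₁ h₂ =>
    rw [hV.value_eq_of_red h₁, hV.value_eq_of_red h₂]
    exact inf_le_left.trans le_sup_left
  | cut_rule _ h₁ h₂ _ _ ih₁ ih₂ =>
    simp only [← hV.value_eq_of_red h₁, ← hV.value_eq_of_red h₂] at ih₁ ih₂
    exact le_of_le_sup_of_inf_le (ih₁ σ) (ih₂ σ)
  | contr_left h₁ h₂ _ ih =>
    simpa only [← hV.value_eq_of_red h₁, ← hV.value_eq_of_red h₂, inf_left_idem] using ih σ
  | contr_right h₁ h₂ _ ih =>
    simpa only [← hV.value_eq_of_red h₁, ← hV.value_eq_of_red h₂, sup_left_idem] using ih σ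
  | weak_left _ ih => exact inf_le_right.trans (ih σ)
  | weak_right _ ih => exact (ih σ).trans le_sup_right
  | imp_left h _ _ ih₁ ih₂ =>
    simpa only [hV.value_eq_of_red h, value] using himp_inf_le_of_le_sup_of_inf_le (ih₁ σ) (ih₂ σ)
  | imp_right h _ ih =>
    simpa only [hV.value_eq_of_red h, value] using le_himp_sup_of_inf_le_sup (ih σ)
  | and_left h _ ih => simpa only [hV.value_eq_of_red h, value, inf_assoc] using ih σ
  | and_right h _ _ ih₁ ih₂ =>
    simpa only [hV.value_eq_of_red h, value, sup_inf_right] using le_inf (ih₁ σ) (ih₂ σ)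
  | or_left h _ _ ih₁ ih₂ =>
    simpa only [hV.value_eq_of_red h, value, inf_sup_right] using sup_le (ih₁ σ) (ih₂ σ)
  | or_right h _ ih => simpa only [hV.value_eq_of_red h, value, sup_assoc] using ih σ
  | bot_left h => simp only [hV.value_eq_of_red h, value, bot_inf_eq, bot_le]
  | all_left t h _ ih =>
    rw [hV.value_eq_of_red h]
    exact (inf_le_inf_right _ (value_all_le_value_inst _ t σ)).trans (ih σ)
  | all_right h _ ih =>
    rw [hV.value_eq_of_red h, value, iInf_sup_eq]
    exact le_iInf fun t => by simpa only [map_value_map_shift] using ih (scons t σ)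
  | ex_left h _ ih =>
    rw [hV.value_eq_of_red h, value, iSup_inf_eq]
    exact iSup_le fun t => by simpa only [map_value_map_shift] using ih (scons t σ)
  | ex_right t h _ ih =>
    rw [hV.value_eq_of_red h]
    exact (ih σ).trans (sup_le_sup_right (value_inst_le_value_ex _ t σ) _)

/-! ## The Boolean algebra of cut-free provability -/

theorem Provable.subst {cut : Bool} {Γ Δ : Multiset (Formula L)} (p : Provable R cut Γ Δ)
    (σ : ℕ → L.Term ℕ) : Provable R cut (Γ.map (·.subst σ)) (Δ.map (·.subst σ)) := by
  induction p generalizing σ with simp only [Multiset.map_cons] at *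
  | ax h₁ h₂ => exact .ax (h₁.subst σ) (h₂.subst σ)
  | cut_rule hcut h₁ h₂ _ _ ih₁ ih₂ =>
    exact .cut_rule hcut (h₁.subst σ) (h₂.subst σ) (ih₁ σ) (ih₂ σ)
  | contr_left h₁ h₂ _ ih => exact .contr_left (h₁.subst σ) (h₂.subst σ) (ih σ)
  | contr_right h₁ h₂ _ ih => exact .contr_right (h₁.subst σ) (h₂.subst σ) (ih σ)
  | weak_left _ ih => exact .weak_left (ih σ)
  | weak_right _ ih => exact .weak_right (ih σ)
  | imp_left h _ _ ih₁ ih₂ => exact .imp_left (h.subst σ) (ih₁ σ) (ih₂ σ)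
  | imp_right h _ ih => exact .imp_right (h.subst σ) (ih σ)
  | and_left h _ ih => exact .and_left (h.subst σ) (ih σ)
  | and_right h _ _ ih₁ ih₂ => exact .and_right (h.subst σ) (ih₁ σ) (ih₂ σ)
  | or_left h _ _ ih₁ ih₂ => exact .or_left (h.subst σ) (ih₁ σ) (ih₂ σ)
  | or_right h _ ih => exact .or_right (h.subst σ) (ih σ)
  | bot_left h => exact .bot_left (h.subst σ)
  | all_left t h _ ih =>
    refine .all_left (t.subst σ) (h.subst σ) ?_
    simpa only [Formula.inst_subst, Formula.subst_up_inst] using ih σ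
  | all_right h _ ih =>
    exact .all_right (h.subst σ) (by simpa only [Formula.map_shift_map_subst_up] using ih (up σ))
  | ex_left h _ ih =>
    exact .ex_left (h.subst σ) (by simpa only [Formula.map_shift_map_subst_up] using ih (up σ))
  | ex_right t h _ ih =>
    refine .ex_right (t.subst σ) (h.subst σ) ?_
    simpa only [Formula.inst_subst, Formula.subst_up_inst] using ih σ

section Structural

variable {cut : Bool} {Γ Δ : Multiset (Formula L)}

theorem Provable.weaken (p : Provable R cut Γ Δ) (Γ' Δ' : Multiset (Formula L)) :
    Provable R cut (Γ + Γ') (Δ + Δ') := by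
  have hleft : Provable R cut (Γ + Γ') Δ := by
    induction Γ' using Multiset.induction with
    | empty => rwa [add_zero]
    | cons A Γ' ih =>
      rw [Multiset.add_cons]
      exact ih.weak_left
  induction Δ' using Multiset.induction with
  | empty => rwa [add_zero]
  | cons A Δ' ih =>
    rw [Multiset.add_cons]
    exact ih.weak_right

theorem Provable.contract_left {Γ' : Multiset (Formula L)} (p : Provable R cut (Γ + Γ + Γ') Δ) :
    Provable R cut (Γ + Γ') Δ := by
  induction Γ using Multiset.induction generalizing Γ' with
  | empty => simpa only [zero_add] using p
  | cons A Γ ih =>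
    have hAA : Provable R cut (Γ + (A ::ₘ A ::ₘ Γ')) Δ :=
      ih <| by simpa only [Multiset.cons_add, Multiset.add_cons] using p
    rw [Multiset.cons_add]
    exact .contr_left (Red.refl A) (Red.refl A) (by simpa only [Multiset.add_cons] using hAA)

theorem Provable.contract_right {Δ' : Multiset (Formula L)} (p : Provable R cut Γ (Δ + Δ + Δ')) :
    Provable R cut Γ (Δ + Δ') := by
  induction Δ using Multiset.induction generalizing Δ' with
  | empty => simpa only [zero_add] using p
  | cons A Δ ih =>
    have hAA : Provable R cut Γ (Δ + (A ::ₘ A ::ₘ Δ')) :=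
      ih <| by simpa only [Multiset.cons_add, Multiset.add_cons] using p
    rw [Multiset.cons_add]
    exact .contr_right (Red.refl A) (Red.refl A) (by simpa only [Multiset.add_cons] using hAA)

end Structural

/-- The cut-free provable sequents. A sequent is encoded as a pair, so that adding two sequents
merges their left-hand sides and their right-hand sides. -/
def cutFreeProvable (R : RewriteSystem L) : Set (Multiset (Formula L) × Multiset (Formula L)) :=
  {m | Provable R false m.1 m.2}

theorem mem_cutFreeProvable {m : Multiset (Formula L) × Multiset (Formula L)} :
    m ∈ cutFreeProvable R ↔ Provable R false m.1 m.2 := Iff.rfl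

instance : IsPole (cutFreeProvable R) where
  add_mem h n := h.weaken n.1 n.2
  mem_of_add_self_mem {m} h := by
    rw [mem_cutFreeProvable, ← add_zero (m + m).1] at h
    have hleft : Provable R false m.1 (m + m).2 := by simpa only [add_zero] using h.contract_left
    rw [← add_zero (m + m).2] at hleft
    simpa only [mem_cutFreeProvable, add_zero] using hleft.contract_right

/-- The facts of the phase semantics whose pole is the set of cut-free provable sequents. -/
abbrev CutFreeFact (R : RewriteSystem L) : Type _ := PhaseFact (cutFreeProvable R)

/-- The fact of the sequents that are cut-free provable once `A` is added on the left. -/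
def leftFact (R : RewriteSystem L) (A : Formula L) : CutFreeFact R :=
  polar (cutFreeProvable R) ({A}, 0)

/-- The fact of the sequents that are cut-free provable once `A` is added on the right. -/
def rightFact (R : RewriteSystem L) (A : Formula L) : CutFreeFact R :=
  polar (cutFreeProvable R) (0, {A})

section Rules

variable {A B : Formula L} {m : Multiset (Formula L) × Multiset (Formula L)}

theorem mem_extent_leftFact :
    m ∈ (leftFact R A).extent ↔ Provable R false (A ::ₘ m.1) m.2 := by
  simp only [leftFact, mem_extent_polar, mem_cutFreeProvable, Prod.fst_add, Prod.snd_add,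
    add_zero, add_comm m.1, Multiset.singleton_add]

theorem mem_extent_rightFact :
    m ∈ (rightFact R A).extent ↔ Provable R false m.1 (A ::ₘ m.2) := by
  simp only [rightFact, mem_extent_polar, mem_cutFreeProvable, Prod.fst_add, Prod.snd_add,
    add_zero, add_comm m.2, Multiset.singleton_add]

theorem mem_extent_leftFact_sup_rightFact :
    m ∈ (leftFact R A ⊔ rightFact R B).extent ↔ Provable R false (A ::ₘ m.1) (B ::ₘ m.2) := by
  simp only [leftFact, rightFact, mem_extent_polar_sup_polar, mem_cutFreeProvable, Prod.fst_add,
    Prod.snd_add, add_zero, zero_add, add_comm m.1, add_comm m.2, Multiset.singleton_add]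

theorem mem_extent_leftFact_sup_leftFact :
    m ∈ (leftFact R A ⊔ leftFact R B).extent ↔ Provable R false (A ::ₘ B ::ₘ m.1) m.2 := by
  simp only [leftFact, mem_extent_polar_sup_polar, mem_cutFreeProvable, Prod.fst_add, Prod.snd_add,
    add_zero, add_comm m.1, Multiset.singleton_add, Multiset.cons_add]

theorem mem_extent_rightFact_sup_rightFact :
    m ∈ (rightFact R A ⊔ rightFact R B).extent ↔ Provable R false m.1 (A ::ₘ B ::ₘ m.2) := by
  simp only [rightFact, mem_extent_polar_sup_polar, mem_cutFreeProvable, Prod.fst_add, Prod.snd_add,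
    add_zero, add_comm m.2, Multiset.singleton_add, Multiset.cons_add]

theorem codisjoint_leftFact_rightFact (h : Relation.Join (Red R) A B) :
    Codisjoint (leftFact R A) (rightFact R B) := by
  obtain ⟨C, hA, hB⟩ := h
  exact codisjoint_iff_le_sup.2 fun _ _ => mem_extent_leftFact_sup_rightFact.2 (.ax hA hB)

theorem rightFact_inf_leftFact_le_leftFact_imp :
    rightFact R A ⊓ leftFact R B ≤ leftFact R (.imp A B) := fun _ ⟨hA, hB⟩ =>
  mem_extent_leftFact.2 <|
    .imp_left (Red.refl _) (mem_extent_rightFact.1 hA) (mem_extent_leftFact.1 hB)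

theorem leftFact_sup_rightFact_le_rightFact_imp :
    leftFact R A ⊔ rightFact R B ≤ rightFact R (.imp A B) := fun _ h =>
  mem_extent_rightFact.2 <| .imp_right (Red.refl _) (mem_extent_leftFact_sup_rightFact.1 h)

theorem leftFact_sup_leftFact_le_leftFact_and :
    leftFact R A ⊔ leftFact R B ≤ leftFact R (.and A B) := fun _ h =>
  mem_extent_leftFact.2 <| .and_left (Red.refl _) (mem_extent_leftFact_sup_leftFact.1 h)

theorem rightFact_inf_rightFact_le_rightFact_and :
    rightFact R A ⊓ rightFact R B ≤ rightFact R (.and A B) := fun _ ⟨hA, hB⟩ =>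
  mem_extent_rightFact.2 <|
    .and_right (Red.refl _) (mem_extent_rightFact.1 hA) (mem_extent_rightFact.1 hB)

theorem leftFact_inf_leftFact_le_leftFact_or :
    leftFact R A ⊓ leftFact R B ≤ leftFact R (.or A B) := fun _ ⟨hA, hB⟩ =>
  mem_extent_leftFact.2 <|
    .or_left (Red.refl _) (mem_extent_leftFact.1 hA) (mem_extent_leftFact.1 hB)

theorem rightFact_sup_rightFact_le_rightFact_or :
    rightFact R A ⊔ rightFact R B ≤ rightFact R (.or A B) := fun _ h =>
  mem_extent_rightFact.2 <| .or_right (Red.refl _) (mem_extent_rightFact_sup_rightFact.1 h)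

theorem top_le_leftFact_bot : ⊤ ≤ leftFact R .bot := fun _ _ =>
  mem_extent_leftFact.2 <| .bot_left (Red.refl _)

theorem leftFact_inst_le_leftFact_all (A : Formula L) (t : L.Term ℕ) :
    leftFact R (A.inst t) ≤ leftFact R (.all A) := fun _ h =>
  mem_extent_leftFact.2 <| .all_left t (Red.refl _) (mem_extent_leftFact.1 h)

theorem rightFact_inst_le_rightFact_ex (A : Formula L) (t : L.Term ℕ) :
    rightFact R (A.inst t) ≤ rightFact R (.ex A) := fun _ h =>
  mem_extent_rightFact.2 <| .ex_right t (Red.refl _) (mem_extent_rightFact.1 h)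

theorem iInf_rightFact_inst_le_rightFact_all (A : Formula L) :
    ⨅ t, rightFact R (A.inst t) ≤ rightFact R (.all A) := by
  rintro ⟨Γ, Δ⟩ h
  obtain ⟨N, hΓ, hΔ, hA⟩ := ((Formula.eventually_map_subst_bindVar Γ).and <|
    (Formula.eventually_map_subst_bindVar Δ).and A.eventually_inst_var_subst_bindVar).exists
  have hN : Provable R false Γ (A.inst (Term.var N) ::ₘ Δ) :=
    mem_extent_rightFact.1 (iInf_le (fun t => rightFact R (A.inst t)) _ h)
  refine mem_extent_rightFact.2 (.all_right (Red.refl _) ?_)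
  simpa only [Multiset.map_cons, hΓ, hΔ, hA] using hN.subst (bindVar N)

theorem iInf_leftFact_inst_le_leftFact_ex (A : Formula L) :
    ⨅ t, leftFact R (A.inst t) ≤ leftFact R (.ex A) := by
  rintro ⟨Γ, Δ⟩ h
  obtain ⟨N, hΓ, hΔ, hA⟩ := ((Formula.eventually_map_subst_bindVar Γ).and <|
    (Formula.eventually_map_subst_bindVar Δ).and A.eventually_inst_var_subst_bindVar).exists
  have hN : Provable R false (A.inst (Term.var N) ::ₘ Γ) Δ :=
    mem_extent_leftFact.1 (iInf_le (fun t => leftFact R (A.inst t)) _ h)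
  refine mem_extent_leftFact.2 (.ex_left (Red.refl _) ?_)
  simpa only [Multiset.map_cons, hΓ, hΔ, hA] using hN.subst (bindVar N)

end Rules

/-! ## Redundancy of cuts from confluence -/

/-- The valuation of the atomic propositions by which confluence yields redundancy of cuts. The
value of an atom is the greatest fact that is below `rightFact` for all propositions joinable with
the atom, which makes it invariant under rewriting. -/
def cutFreeValuation (R : RewriteSystem L) : AtomValuation L (CutFreeFact R) := fun _ P ts =>
  ⨅ (B) (_ : Relation.Join (Red R) (.atom P ts) B), rightFact R B

theorem RewriteSystem.Confluent.rewriteInvariant_cutFreeValuation (hR : R.Confluent) :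
    (cutFreeValuation R).RewriteInvariant R := fun _ P ts us h => by
  simp only [cutFreeValuation, hR.join_step_atom_iff h]

theorem cutFreeValuation_le_rightFact {n : ℕ} (P : L.Relations n) (ts : Fin n → L.Term ℕ) :
    cutFreeValuation R P ts ≤ rightFact R (.atom P ts) :=
  iInf₂_le _ ⟨_, Red.refl _, Red.refl _⟩

theorem compl_cutFreeValuation_le_leftFact {n : ℕ} (P : L.Relations n) (ts : Fin n → L.Term ℕ) :
    (cutFreeValuation R P ts)ᶜ ≤ leftFact R (.atom P ts) := by
  simp only [cutFreeValuation, compl_iInf, iSup_le_iff]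
  exact fun B h => codisjoint_iff_compl_le_left.1 (codisjoint_leftFact_rightFact h)

theorem compl_value_le_leftFact_and_value_le_rightFact (A : Formula L) (σ : ℕ → L.Term ℕ) :
    (value (cutFreeValuation R) A σ)ᶜ ≤ leftFact R (A.subst σ) ∧
      value (cutFreeValuation R) A σ ≤ rightFact R (A.subst σ) := by
  induction A generalizing σ with
  | atom P ts =>
    exact ⟨compl_cutFreeValuation_le_leftFact P _, cutFreeValuation_le_rightFact P _⟩
  | bot => exact ⟨le_top.trans top_le_leftFact_bot, bot_le⟩
  | imp A B ihA ihB =>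
    simp only [value, himp_eq, compl_sup, compl_compl]
    rw [inf_comm, sup_comm]
    exact ⟨(inf_le_inf (ihA σ).2 (ihB σ).1).trans rightFact_inf_leftFact_le_leftFact_imp,
      (sup_le_sup (ihA σ).1 (ihB σ).2).trans leftFact_sup_rightFact_le_rightFact_imp⟩
  | and A B ihA ihB =>
    simp only [value, compl_inf]
    exact ⟨(sup_le_sup (ihA σ).1 (ihB σ).1).trans leftFact_sup_leftFact_le_leftFact_and,
      (inf_le_inf (ihA σ).2 (ihB σ).2).trans rightFact_inf_rightFact_le_rightFact_and⟩
  | or A B ihA ihB =>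
    simp only [value, compl_sup]
    exact ⟨(inf_le_inf (ihA σ).1 (ihB σ).1).trans leftFact_inf_leftFact_le_leftFact_or,
      (sup_le_sup (ihA σ).2 (ihB σ).2).trans rightFact_sup_rightFact_le_rightFact_or⟩
  | all A ih =>
    have hinst t := A.subst_up_inst t σ ▸ ih (scons t σ)
    simp only [value, compl_iInf]
    exact ⟨iSup_le fun t => (hinst t).1.trans (leftFact_inst_le_leftFact_all _ t),
      (iInf_mono fun t => (hinst t).2).trans (iInf_rightFact_inst_le_rightFact_all _)⟩
  | ex A ih =>
    have hinst t := A.subst_up_inst t σ ▸ ih (scons t σ)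
    simp only [value, compl_iSup]
    exact ⟨(iInf_mono fun t => (hinst t).1).trans (iInf_leftFact_inst_le_leftFact_ex _),
      iSup_le fun t => (hinst t).2.trans (rightFact_inst_le_rightFact_ex _ t)⟩

theorem compl_inf_value_le_polar (Γ : Multiset (Formula L)) :
    ((Γ.map (value (cutFreeValuation R) · Term.var)).inf)ᶜ ≤ polar (cutFreeProvable R) (Γ, 0) := by
  induction Γ using Multiset.induction with
  | empty => simp only [Multiset.map_zero, Multiset.inf_zero, compl_top, bot_le]
  | cons A Γ ih =>
    have hA := (compl_value_le_leftFact_and_value_le_rightFact (R := R) A Term.var).1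
    rw [A.subst_var] at hA
    rw [Multiset.map_cons, Multiset.inf_cons, compl_inf,
      show ((A ::ₘ Γ, 0) : _ × Multiset (Formula L)) = ({A}, 0) + (Γ, 0) from rfl, polar_add]
    exact sup_le_sup hA ih

theorem sup_value_le_polar (Δ : Multiset (Formula L)) :
    (Δ.map (value (cutFreeValuation R) · Term.var)).sup ≤ polar (cutFreeProvable R) (0, Δ) := by
  induction Δ using Multiset.induction with
  | empty => simp only [Multiset.map_zero, Multiset.sup_zero, bot_le]
  | cons A Δ ih =>
    have hA := (compl_value_le_leftFact_and_value_le_rightFact (R := R) A Term.var).2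
    rw [A.subst_var] at hA
    rw [Multiset.map_cons, Multiset.sup_cons,
      show ((0, A ::ₘ Δ) : Multiset (Formula L) × _) = (0, {A}) + (0, Δ) from rfl, polar_add]
    exact sup_le_sup hA ih

theorem RewriteSystem.Confluent.cutRedundant (hR : R.Confluent) : CutRedundant R := by
  intro Γ Δ p
  have hΓΔ := p.inf_value_le_sup_value hR.rewriteInvariant_cutFreeValuation Term.var
  refine mem_of_polar_eq_top (S := cutFreeProvable R) (m := (Γ, Δ)) (top_le_iff.1 ?_)
  calc
    ⊤ = (Γ.map (value (cutFreeValuation R) · Term.var)).infᶜ ⊔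
          (Γ.map (value (cutFreeValuation R) · Term.var)).inf := compl_sup_eq_top.symm
    _ ≤ polar (cutFreeProvable R) (Γ, 0) ⊔ polar (cutFreeProvable R) (0, Δ) :=
      sup_le_sup (compl_inf_value_le_polar Γ) (hΓΔ.trans (sup_value_le_polar Δ))
    _ = polar (cutFreeProvable R) (Γ, Δ) := by
      rw [← polar_add, Prod.mk_add_mk, add_zero, zero_add]

end AsymmetricModulo

theorem mainTheorem2 {L : FirstOrder.Language.{u, v}}
    (hL : ∃ n : ℕ, Nonempty (L.Relations (n + 1)))
    (R : AsymmetricModulo.RewriteSystem L) :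
    AsymmetricModulo.CutRedundant R ↔ R.Confluent := by
  obtain ⟨n, ⟨P⟩⟩ := hL
  exact ⟨fun h => h.confluent P, fun h => h.cutRedundant⟩
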